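/- Call a finite graph $G$ *set-sequential* if for some $n$ its vertices can be labeled with distinct nonzero vectors of $\mathbb{F}_2^n$ such that, when each edge is labeled with the sum of the labels of its two endpoints, every nonzero vector of $\mathbb{F}_2^n$ is used exactly once as the label of a vertex or of an edge. A *caterpillar* is a tree containing some path from which every vertex has distance at most $1$. **Theorem.** Let $T$ be a caterpillar such that every vertex of $T$ has odd degree, the diameter of $T$ is at most $18$, and $|V(T)| = 2^{m}$ for some integer $m \ge 0$. Then $T$ is set-sequential. -/

import Mathlib

namespace SimpleGraph

variable {V : Type*}

/-- The label of a vertex or of an edge of `G` induced by a labeling `f` of the vertices with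
vectors of `𝔽₂ⁿ`: a vertex `v` carries `f v`, an edge `uv` carries `f u + f v`. -/
def inducedLabel (G : SimpleGraph V) {n : ℕ} (f : V → Fin n → ZMod 2) :
    V ⊕ G.edgeSet → Fin n → ZMod 2
  | Sum.inl v => f v
  | Sum.inr e => Sym2.lift ⟨fun u v => f u + f v, fun u v => add_comm (f u) (f v)⟩ (e : Sym2 V)

/-- `f` is a set-sequential labeling of `G`: the vertices carry distinct nonzero vectors, and
every nonzero vector is used exactly once as the label of a vertex or of an edge. -/
structure IsSetSequentialLabeling (G : SimpleGraph V) {n : ℕ} (f : V → Fin n → ZMod 2) :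
    Prop where
  injective : Function.Injective f
  ne_zero : ∀ v, f v ≠ 0
  existsUnique : ∀ x : Fin n → ZMod 2, x ≠ 0 → ∃! s : V ⊕ G.edgeSet, G.inducedLabel f s = x

/-- A graph is set-sequential if it has a set-sequential labeling in some `𝔽₂ⁿ`. -/
def IsSetSequential (G : SimpleGraph V) : Prop :=
  ∃ (n : ℕ) (f : V → Fin n → ZMod 2), G.IsSetSequentialLabeling f

/-- A caterpillar is a tree containing a path from which every vertex has distance at most 1. -/
def IsCaterpillar (G : SimpleGraph V) : Prop :=
  G.IsTree ∧ ∃ (u v : V) (p : G.Walk u v), p.IsPath ∧ ∀ x : V, ∃ y ∈ p.support, G.dist x y ≤ 1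

end SimpleGraph

/-!
An odd caterpillar of small diameter is labeled with vectors `(1, *)` of `𝔽₂ᵐ⁺¹ = 𝔽₂ × 𝔽₂ᵐ` on its
`2 ^ m` vertices and `(0, *)` on its edges. Root the tree at one end of the spine
`s 0, …, s (r - 1)`, and pair the label of each vertex with the label of the edge to its parent, and
the label of the root with `0`. The difference of a pair is the label of the parent, a spine vertex,
where the root counts as its own parent. So what is needed is a perfect matching between the vectors `(1, *)` and the vectors `(0, *)` whose
differences are the spine labels `(1, t i)`, used with prescribed multiplicities `d i`, and which
contains the pairs forced by the spine itself (`IsSpineMatching`). Oddness of the degrees means that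
all `d i` are even, and a shortest spine makes them at least 2 (`IsRootedSpine.card_fiber`,
`IsCaterpillar.exists_isRootedSpine`). Conversely, such a matching gives a set-sequential labeling
(`IsRootedSpine.isSetSequential`).

Since all differences lie in one affine hyperplane, a theorem of M. Hall
(`exists_perm_bijective_add`) matches a whole coset of `𝔽₂ᵐ` by any `2 ^ m` differences with sum
zero. Therefore a matching on `𝔽₂ᵐ` extends to `𝔽₂ᵐ⁺¹` for every larger choice of even
multiplicities (`HasSpineMatching.step`). The matching extended in this way may have odd
multiplicities, so it suffices to have, for each length `r` of the spine, a single small matching in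
which all multiplicities are at most 2 (`HasSpineMatching.of_core`): it lies below all admissible
multiplicities at once. If its last multiplicity is 0, it also serves spines with one vertex fewer.
Diameter at most 18 means `r ≤ 17`, and for these lengths nine explicit matchings suffice
(`hasSpineMatching_of_even`).
-/

/-! ### Hall's theorem in elementary abelian 2-groups -/

section Hall

variable {H : Type*} [AddCommGroup H]

/-- If `a` and `b` lie on one cycle of `f`, then composing `f` with the transposition of `a` and `b`
splits that cycle between them. -/
theorem not_sameCycle_or_not_sameCycle_swap_mul {α : Type*} [DecidableEq α] [Finite α]
    (f : Equiv.Perm α) {a b : α} (hab : a ≠ b) :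
    ¬ f.SameCycle b a ∨ ¬ (Equiv.swap a b * f).SameCycle b a := by
  by_contra! h
  obtain ⟨h1, h2⟩ := h
  have hex : ∃ k : ℕ, (f ^ k) b = a := by
    obtain ⟨k, hk⟩ := h1.exists_nat_pow_eq
    exact ⟨k, hk⟩
  classical
  obtain ⟨L, hL, hmin⟩ : ∃ L : ℕ, (f ^ L) b = a ∧ ∀ k < L, (f ^ k) b ≠ a :=
    ⟨Nat.find hex, Nat.find_spec hex, fun k hk => Nat.find_min hex hk⟩
  have hL0 : L ≠ 0 := by
    rintro rfl
    exact hab (by simpa using hL.symm)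
  -- before time `L` the orbit of `b` under `f` returns to `b` only at time `0`
  have hne : ∀ k, 0 < k → k < L → (f ^ k) b ≠ b := by
    intro k hk0 hk hb
    apply hmin (L - k) (by omega)
    rw [← hL]
    conv_rhs => rw [show L = (L - k) + k by omega, pow_add, Equiv.Perm.mul_apply, hb]
  have hpow : ∀ k, k < L → ((Equiv.swap a b * f) ^ k) b = (f ^ k) b := by
    intro k
    induction k with
    | zero => simp
    | succ k ih =>
      intro hk
      rw [pow_succ', Equiv.Perm.mul_apply, ih (by omega), Equiv.Perm.mul_apply,
        ← Equiv.Perm.mul_apply f, ← pow_succ',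
        Equiv.swap_apply_of_ne_of_ne (hmin _ hk) (hne _ (by omega) hk)]
  have hper : ((Equiv.swap a b * f) ^ L) b = b := by
    obtain ⟨l, rfl⟩ := Nat.exists_eq_succ_of_ne_zero hL0
    rw [pow_succ', Equiv.Perm.mul_apply, hpow l (by omega), Equiv.Perm.mul_apply,
      ← Equiv.Perm.mul_apply f, ← pow_succ', hL, Equiv.swap_apply_left]
  obtain ⟨k, hk⟩ := h2.exists_nat_pow_eq
  have hmod : ((Equiv.swap a b * f) ^ (k % L)) b = a := by
    have hfix : ∀ j : ℕ, (((Equiv.swap a b * f) ^ L) ^ j) b = b := by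
      intro j
      induction j with
      | zero => simp
      | succ j ih => rw [pow_succ, Equiv.Perm.mul_apply, hper, ih]
    rw [← Nat.mod_add_div k L, pow_add, pow_mul, Equiv.Perm.mul_apply, hfix] at hk
    exact hk
  have hlt := Nat.mod_lt k (Nat.pos_of_ne_zero hL0)
  rw [hpow _ hlt] at hmod
  exact hmin _ hlt hmod

theorem add_add_cancel_of_two (h2 : ∀ x : H, x + x = 0) (x y : H) : x + (x + y) = y := by
  rw [← add_assoc, h2, zero_add]

/-- The exchange step in Hall's theorem: if the differences `b` are realized by a bijection
`x ↦ x + b x`, and two of them, `b p` and `b q`, are replaced by two others with the same sum, then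
the new differences are realized up to a permutation `σ` of the positions. In terms of
`g x = x + b x + C`, with `C` chosen so that the position `p` can keep its new difference and be
sent to `q + C`, the permutation `σ` is a single cycle of `g⁻¹`, the one through `q`; if that cycle
also contains `p`, it is first cut by the transposition of `p` and `q`. -/
theorem exchange_of_bijective [Finite H] (h2 : ∀ x : H, x + x = 0) {b b' : H → H} {p q : H}
    (hpq : p ≠ q) (hb : Function.Bijective fun x => x + b x)
    (hsum : b p + b q = b' p + b' q) (hoff : ∀ x, x ≠ p → x ≠ q → b' x = b x) :
    ∃ σ : Equiv.Perm H, Function.Bijective fun x => x + b' (σ x) := by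
  classical
  cases nonempty_fintype H
  have hc := add_add_cancel_of_two h2
  obtain ⟨C, hC⟩ : ∃ C : H, C = p + q + b' p := ⟨_, rfl⟩
  have hg : Function.Bijective fun x => (x + b x) + C :=
    (Equiv.addRight C).bijective.comp hb
  let g : Equiv.Perm H := Equiv.ofBijective _ hg
  have hgdef : ∀ x, g x = x + b x + C := fun x => rfl
  -- `f` is `g⁻¹`, corrected by a transposition when `p` and `q` lie on the same cycle
  obtain ⟨f, hf, hpf⟩ : ∃ f : Equiv.Perm H,
      (f = g⁻¹ ∨ f = Equiv.swap p q * g⁻¹) ∧ ¬ f.SameCycle q p := by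
    rcases not_sameCycle_or_not_sameCycle_swap_mul g⁻¹ hpq with h | h
    exacts [⟨_, Or.inl rfl, h⟩, ⟨_, Or.inr rfl, h⟩]
  have hfoff : ∀ x, x ≠ p → x ≠ q → f⁻¹ x = g x := by
    intro x hp hq
    rcases hf with rfl | rfl
    · simp
    · simp [Equiv.swap_apply_of_ne_of_ne hp hq]
  have hfpq : f⁻¹ p + f⁻¹ q = g p + g q := by
    rcases hf with rfl | rfl
    · simp
    · simp [add_comm]
  set σ := f.cycleOf q with hσ
  have hσp : σ p = p := Equiv.Perm.cycleOf_apply_of_not_sameCycle hpf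
  set z := f⁻¹ q with hz
  have hσz : σ z = q := by
    have : f.SameCycle q z := by
      rw [hz, ← Equiv.Perm.sameCycle_apply_right, show f (f⁻¹ q) = q from f.apply_symm_apply q]
    rw [hσ, this.cycleOf_apply, hz]; simp
  have hfi : ∀ x, f⁻¹ (f x) = x := f.symm_apply_apply
  have hzp : z ≠ p := by
    rintro h
    rw [h, hσp] at hσz
    exact hpq hσz
  -- up to the translation by `C`, the new map is `f⁻¹` off the cycle of `q` and `f` on it,
  -- precomposed with the transposition of `p` and `z = f⁻¹ q`
  have key : ∀ x, x + b' (σ x) = (f⁻¹ * σ * σ * Equiv.swap p z) x + C := by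
    intro x
    rw [Equiv.Perm.mul_apply, Equiv.Perm.mul_apply, Equiv.Perm.mul_apply]
    by_cases hxp : x = p
    · subst hxp
      rw [Equiv.swap_apply_left, hσz, hσp]
      have : σ q = f q := by simp [hσ]
      rw [this]
      rw [hfi, hC]
      rw [show q + (x + q + b' x) = q + (q + (x + b' x)) by abel, hc]
    by_cases hxz : x = z
    · rw [hxz, Equiv.swap_apply_right, hσp, hσp, hσz]
      have e1 : f⁻¹ p + z = g p + g q := hfpq
      have e2 : f⁻¹ p = z + (g p + g q) := by rw [← e1, add_comm, add_assoc, h2, add_zero]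
      rw [e2, hgdef, hgdef]
      have e3 : b' q = b' p + (b p + b q) := by rw [hsum, hc]
      rw [e3]
      calc z + (b' p + (b p + b q))
          = z + (b' p + (b p + b q)) + (p + p) + (q + q) + (C + C) := by simp [h2]
        _ = z + (p + b p + C + (q + b q + C)) + (p + q + b' p) := by abel
        _ = z + (p + b p + C + (q + b q + C)) + C := by rw [← hC]
    rw [Equiv.swap_apply_of_ne_of_ne hxp hxz]
    by_cases hx : f.SameCycle q x
    · have h1 : σ x = f x := hx.cycleOf_apply
      have h3 : σ (f x) = f (f x) := (Equiv.Perm.sameCycle_apply_right.2 hx).cycleOf_apply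
      rw [h1, h3, hfi]
      have hfp : f x ≠ p := by
        intro h; exact hpf (h ▸ Equiv.Perm.sameCycle_apply_right.2 hx)
      have hfq : f x ≠ q := by
        intro h; apply hxz; rw [hz, ← h]; simp
      rw [hoff _ hfp hfq]
      have e := hfoff _ hfp hfq
      rw [hfi, hgdef] at e
      generalize f x = w at e ⊢
      rw [e, show w + b w + C + b w = (b w + b w) + (w + C) by abel, h2, zero_add]
    · have h1 : σ x = x := Equiv.Perm.cycleOf_apply_of_not_sameCycle hx
      have hxq : x ≠ q := by rintro rfl; exact hx (Equiv.Perm.SameCycle.refl _ _)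
      rw [h1, h1, hfoff _ hxp hxq, hgdef, hoff _ hxp hxq, add_assoc, add_assoc, h2, add_zero]
  refine ⟨σ, ?_⟩
  have : (fun x => x + b' (σ x)) = (Equiv.addRight C) ∘ (f⁻¹ * σ * σ * Equiv.swap p z) :=
    funext key
  rw [this]
  exact (Equiv.addRight C).bijective.comp (Equiv.bijective _)

/-- Hall's theorem for elementary abelian 2-groups: every family of `|H|` elements with sum zero
can be arranged as the differences `y - x` of the pairs `(x, y)` of a bijection `H → H`. By
induction on the number of nonzero terms, two of which are merged into one by the exchange step. -/
theorem exists_perm_bijective_add [Fintype H] (h2 : ∀ x : H, x + x = 0) (b : H → H)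
    (hb : ∑ x, b x = 0) :
    ∃ σ : Equiv.Perm H, Function.Bijective fun x => x + b (σ x) := by
  classical
  induction hn : (Finset.univ.filter fun x => b x ≠ 0).card using Nat.strong_induction_on
    generalizing b with
  | _ n ih =>
  by_cases h0 : ∀ x, b x = 0
  · exact ⟨1, by simp [h0]⟩
  push Not at h0
  obtain ⟨p, hp⟩ := h0
  obtain ⟨q, hqp, hq⟩ : ∃ q, q ≠ p ∧ b q ≠ 0 := by
    by_contra! h
    rw [Finset.sum_eq_single p (fun x _ hx => h x hx) (by simp)] at hb
    exact hp hb
  let c : H → H := Function.update (Function.update b p 0) q (b p + b q)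
  have hcq : c q = b p + b q := by simp [c]
  have hcp : c p = 0 := by simp [c, hqp.symm]
  have hcoff : ∀ x, x ≠ p → x ≠ q → c x = b x := fun x h h' => by simp [c, h, h']
  have hcsum : ∑ x, c x = 0 := by
    rw [← hb, ← Finset.sum_erase_add _ _ (Finset.mem_univ p),
      ← Finset.sum_erase_add _ _ (Finset.mem_univ p),
      ← Finset.sum_erase_add _ _ (Finset.mem_erase.2 ⟨hqp, Finset.mem_univ q⟩),
      ← Finset.sum_erase_add _ _ (Finset.mem_erase.2 ⟨hqp, Finset.mem_univ q⟩), hcq, hcp,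
      Finset.sum_congr rfl fun x hx => hcoff x (by simp at hx; tauto) (by simp at hx; tauto)]
    abel
  obtain ⟨τ, hτ⟩ := ih _ (by
    rw [← hn]
    apply Finset.card_lt_card
    refine ⟨fun x hx => ?_, fun h => ?_⟩
    · simp only [Finset.mem_filter, Finset.mem_univ, true_and] at hx ⊢
      by_cases h1 : x = p
      · rwa [h1]
      by_cases h3 : x = q
      · rwa [h3]
      rwa [hcoff x h1 h3] at hx
    · have := h (show p ∈ _ by simpa using hp)
      simp [hcp] at this) c hcsum rfl
  obtain ⟨σ, hσ⟩ := exchange_of_bijective h2 (b := c ∘ τ) (b' := b ∘ τ) (p := τ.symm p)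
    (q := τ.symm q) (by simpa using hqp.symm) hτ (by simp [hcp, hcq])
    (fun x h1 h3 => (hcoff _ (fun h => h1 (by simp [← h])) (fun h => h3 (by simp [← h]))).symm)
  exact ⟨τ * σ, hσ⟩

end Hall

/-! ### Spine matchings -/

/-- A perfect matching between the vectors `y` of `H` (standing for the labels `(1, y)`) and the
vectors `y + t (φ y)` (standing for `(0, y + t (φ y))`), in which the difference of each pair is one
of the distinct vectors `t 0, …, t (r - 1)`, and in which `t i` itself is paired with
`t i + t (i - 1)` for `i > 0`, and `t 0` with `0`. The vectors `t i` are the labels of the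
consecutive vertices of a path; the truncated subtraction `0 - 1 = 0` in `map_spine` makes the root
its own parent, so that the zero vector appears as the label of an absent edge. Values of `t`
beyond `r` are irrelevant. -/
structure IsSpineMatching {H : Type*} [Add H] (r : ℕ) (t : ℕ → H) (φ : H → ℕ) : Prop where
  injOn : Set.InjOn t (Set.Iio r)
  map_spine : ∀ i < r, φ (t i) = i - 1
  map_lt : ∀ y, φ y < r
  bijective : Function.Bijective fun y => y + t (φ y)

/-- There is a spine matching on `𝔽₂ᵐ` for a spine of `r` vertices in which, for every `i < r`, the
difference `t i` is used exactly `d i` times. -/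
def HasSpineMatching (m r : ℕ) (d : ℕ → ℕ) : Prop :=
  ∃ (t : ℕ → Fin m → ZMod 2) (φ : (Fin m → ZMod 2) → ℕ), IsSpineMatching r t φ ∧
    ∀ i < r, (Finset.univ.filter fun y => φ y = i).card = d i

theorem HasSpineMatching.congr {m r : ℕ} {d d' : ℕ → ℕ} (h : HasSpineMatching m r d)
    (hd : ∀ i < r, d i = d' i) : HasSpineMatching m r d' := by
  obtain ⟨t, φ, h1, h2⟩ := h
  exact ⟨t, φ, h1, fun i hi => (h2 i hi).trans (hd i hi)⟩

/-- If the last spine vertex has no children, it may be regarded as a leaf. -/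
theorem HasSpineMatching.of_succ {m r : ℕ} {d : ℕ → ℕ} (h : HasSpineMatching m (r + 1) d)
    (hd : d r = 0) : HasSpineMatching m r d := by
  obtain ⟨t, φ, h1, h2⟩ := h
  refine ⟨t, φ, ⟨h1.injOn.mono fun i hi => Nat.lt_succ_of_lt hi,
    fun i hi => h1.map_spine i (by omega), fun y => ?_, h1.bijective⟩, fun i hi => h2 i (by omega)⟩
  have h3 := h2 r (by omega)
  rw [hd, Finset.card_eq_zero, Finset.filter_eq_empty_iff] at h3
  exact lt_of_le_of_ne (Nat.lt_succ_iff.1 (h1.map_lt y)) (h3 (Finset.mem_univ y))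

theorem HasSpineMatching.sum_eq {m r : ℕ} {d : ℕ → ℕ} (h : HasSpineMatching m r d) :
    ∑ i ∈ Finset.range r, d i = 2 ^ m := by
  obtain ⟨t, φ, h1, h2⟩ := h
  rw [← Finset.sum_congr rfl fun i hi => h2 i (Finset.mem_range.1 hi),
    ← Finset.card_eq_sum_card_fiberwise fun y _ =>
      Finset.mem_coe.2 (Finset.mem_range.2 (h1.map_lt y))]
  simp

/-- The splitting `𝔽₂ᵐ⁺¹ = 𝔽₂ × 𝔽₂ᵐ`. -/
def consAddEquiv (m : ℕ) : ZMod 2 × (Fin m → ZMod 2) ≃+ (Fin (m + 1) → ZMod 2) where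
  toFun p := Fin.cons p.1 p.2
  invFun f := (f 0, Fin.tail f)
  left_inv p := by simp
  right_inv f := by simp
  map_add' p q := by
    funext i
    refine Fin.cases ?_ (fun j => ?_) i <;> simp

theorem exists_fun_card_fiber {H : Type*} [Fintype H] {r : ℕ} (c : ℕ → ℕ)
    (hc : ∑ i ∈ Finset.range r, c i = Fintype.card H) :
    ∃ ψ : H → ℕ, (∀ y, ψ y < r) ∧ ∀ i < r, (Finset.univ.filter fun y => ψ y = i).card = c i := by
  classical
  have hcard : Fintype.card H = Fintype.card (Σ i : Fin r, Fin (c i)) := by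
    simp [← hc, Finset.sum_range]
  let e := Fintype.equivOfCardEq hcard
  refine ⟨fun y => (e y).1, fun y => (e y).1.2, fun i hi => ?_⟩
  rw [← Fintype.card_subtype]
  have e2 : {y : H // ((e y).1 : ℕ) = i} ≃ {x : Σ i : Fin r, Fin (c i) // x.1 = ⟨i, hi⟩} :=
    e.subtypeEquiv fun y => by simp [Fin.ext_iff]
  rw [Fintype.card_congr (e2.trans (Equiv.sigmaSubtype _))]
  simp

theorem sum_comp_eq_sum_nsmul {H A : Type*} [Fintype H] [AddCommGroup A] {r : ℕ} (t : ℕ → A)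
    (φ : H → ℕ) (hφ : ∀ y, φ y < r) :
    ∑ y, t (φ y) = ∑ i ∈ Finset.range r, (Finset.univ.filter fun y => φ y = i).card • t i := by
  rw [← Finset.sum_fiberwise_of_maps_to (s := Finset.univ) (t := Finset.range r) (g := φ)
    fun y _ => Finset.mem_range.2 (hφ y)]
  refine Finset.sum_congr rfl fun i _ => ?_
  rw [Finset.sum_congr rfl fun y hy => by rw [(Finset.mem_filter.1 hy).2], Finset.sum_const]

/-- A spine matching on `𝔽₂ᵐ` extends to one on `𝔽₂ᵐ⁺¹` with any larger even multiplicities of the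
right total: on the new coset Hall's theorem applies to the excess `d - d'`, whose weighted sum of
the `t i` vanishes because the one for `d` does by parity and the one for `d'` does since it is the
sum of all differences of a bijection. The multiplicities `d'` need not be even. -/
theorem HasSpineMatching.step {m r : ℕ} {d d' : ℕ → ℕ} (h : HasSpineMatching m r d')
    (heven : ∀ i < r, Even (d i)) (hle : ∀ i < r, d' i ≤ d i)
    (hsum : ∑ i ∈ Finset.range r, d i = 2 ^ (m + 1)) : HasSpineMatching (m + 1) r d := by
  have hs' := h.sum_eq
  obtain ⟨t, φ, h1, h2⟩ := h
  have htwo : ∀ x : Fin m → ZMod 2, x + x = 0 := fun x => by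
    funext i; exact CharTwo.add_self_eq_zero (x i)
  have hsub : ∑ i ∈ Finset.range r, (d i - d' i) = Fintype.card (Fin m → ZMod 2) := by
    rw [Finset.sum_tsub_distrib _ fun i hi => hle i (Finset.mem_range.1 hi), hsum, hs']
    simp [pow_succ]; omega
  obtain ⟨ψ, hψ, hψc⟩ := exists_fun_card_fiber _ hsub
  have hφ0 : ∑ i ∈ Finset.range r, d' i • t i = 0 := by
    have e1 : ∑ y, (y + t (φ y)) = ∑ y : Fin m → ZMod 2, y :=
      h1.bijective.sum_comp fun y => y
    rw [Finset.sum_add_distrib, sum_comp_eq_sum_nsmul t φ h1.map_lt, add_eq_left] at e1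
    rw [← e1]
    exact Finset.sum_congr rfl fun i hi => by rw [h2 i (Finset.mem_range.1 hi)]
  have hψ0 : ∑ y, t (ψ y) = 0 := by
    rw [sum_comp_eq_sum_nsmul t ψ hψ, ← hφ0]
    refine Finset.sum_congr rfl fun i hi => ?_
    rw [Finset.mem_range] at hi
    rw [hψc i hi]
    obtain ⟨k, hk⟩ := heven i hi
    have e1 : d i • t i = 0 := by rw [hk, add_nsmul, htwo]
    have e2 : (d i - d' i) • t i + d' i • t i = 0 := by
      rw [← add_nsmul, Nat.sub_add_cancel (hle i hi), e1]
    rw [eq_neg_of_add_eq_zero_left e2, neg_eq_iff_add_eq_zero, htwo]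
  obtain ⟨σ, hσ⟩ := exists_perm_bijective_add htwo (fun y => t (ψ y)) hψ0
  let e := consAddEquiv m
  let Φ : ZMod 2 × (Fin m → ZMod 2) → ℕ := fun p => if p.1 = 0 then φ p.2 else ψ (σ p.2)
  refine ⟨fun i => e (0, t i), fun y => Φ (e.symm y), ⟨?_, ?_, ?_, ?_⟩, ?_⟩
  · intro i hi j hj hij
    simp only [EmbeddingLike.apply_eq_iff_eq, Prod.mk.injEq, true_and] at hij
    exact h1.injOn hi hj hij
  · intro i hi
    simp [Φ, h1.map_spine i hi]
  · intro y
    simp only [Φ]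
    split
    exacts [h1.map_lt _, hψ _]
  · have hbij : Function.Bijective fun p : ZMod 2 × (Fin m → ZMod 2) => p + (0, t (Φ p)) := by
      rw [Finite.injective_iff_bijective.symm]
      rintro ⟨a, x⟩ ⟨b, y⟩ hxy
      simp only [Prod.mk_add_mk, add_zero, Prod.mk.injEq] at hxy
      obtain ⟨rfl, hxy⟩ := hxy
      by_cases ha : a = 0
      · simp only [Φ, ha, if_true] at hxy
        rw [h1.bijective.1 hxy]
      · simp only [Φ, ha, if_false] at hxy
        rw [hσ.1 hxy]
    convert (e.bijective.comp hbij).comp e.symm.bijective using 1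
    funext y
    simp [map_add]
  · intro i hi
    rw [← Fintype.card_subtype]
    have e1 : {y // Φ (e.symm y) = i} ≃ {p // Φ p = i} :=
      e.symm.toEquiv.subtypeEquiv fun y => Iff.rfl
    have e2 : (Finset.univ.filter fun y => ψ (σ y) = i).card = d i - d' i := by
      rw [← hψc i hi, ← Fintype.card_subtype, ← Fintype.card_subtype]
      exact Fintype.card_congr (σ.subtypeEquiv fun y => Iff.rfl)
    rw [Fintype.card_congr e1, Fintype.card_subtype, Finset.card_filter, Fintype.sum_prod_type]
    have e3 : ∀ F : ZMod 2 → ℕ, ∑ a, F a = F 0 + F 1 := fun F => Fin.sum_univ_two F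
    rw [e3]
    simp only [Φ, if_true, one_ne_zero, if_false]
    rw [← Finset.card_filter, ← Finset.card_filter, e2, h2 i hi]
    have := hle i hi
    omega

theorem exists_between_sum_eq {r M : ℕ} (a b : ℕ → ℕ) (hab : ∀ i < r, a i ≤ b i)
    (ha : ∑ i ∈ Finset.range r, a i ≤ M) (hb : M ≤ ∑ i ∈ Finset.range r, b i) :
    ∃ c : ℕ → ℕ, (∀ i < r, a i ≤ c i ∧ c i ≤ b i) ∧ ∑ i ∈ Finset.range r, c i = M := by
  induction r generalizing M with
  | zero => exact ⟨a, by simp, by simp at hb ⊢; omega⟩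
  | succ r ih =>
    rw [Finset.sum_range_succ] at ha hb
    have h1 := hab r (by omega)
    have h2 : ∑ i ∈ Finset.range r, a i ≤ ∑ i ∈ Finset.range r, b i :=
      Finset.sum_le_sum fun i hi => hab i (by simp at hi; omega)
    obtain ⟨c, hc, hs⟩ := ih (M := max (∑ i ∈ Finset.range r, a i) (M - b r))
      (fun i hi => hab i (by omega)) (le_max_left _ _) (by omega)
    refine ⟨Function.update c r (M - max (∑ i ∈ Finset.range r, a i) (M - b r)), ?_, ?_⟩
    · intro i hi
      rcases eq_or_ne i r with rfl | hir
      · simp; omega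
      · simpa [hir] using hc i (by omega)
    · rw [Finset.sum_range_succ, Finset.sum_congr rfl fun i hi =>
        show Function.update c r _ i = c i from
          Function.update_of_ne (Finset.mem_range.1 hi).ne _ _, hs, Function.update_self]
      omega

/-- One spine matching with all multiplicities at most 2, on a space which is large enough to
accommodate even multiplicities at least 2 after a single doubling, yields all spine matchings with
such multiplicities on that space and on larger ones. -/
theorem HasSpineMatching.of_core {m₀ m r : ℕ} {d₀ d : ℕ → ℕ} (h : HasSpineMatching m₀ r d₀)
    (hd₀ : ∀ i < r, d₀ i ≤ 2) (hr : 2 * r ≤ 2 ^ (m₀ + 1)) (hm : m₀ ≤ m)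
    (heven : ∀ i < r, Even (d i)) (htwo : ∀ i < r, 2 ≤ d i)
    (hsum : ∑ i ∈ Finset.range r, d i = 2 ^ m) : HasSpineMatching m r d := by
  induction m, hm using Nat.le_induction generalizing d with
  | base =>
    refine h.congr fun i hi => ?_
    have hle : ∀ i ∈ Finset.range r, d₀ i ≤ d i := fun i hi =>
      (hd₀ i (Finset.mem_range.1 hi)).trans (htwo i (Finset.mem_range.1 hi))
    exact (Finset.sum_eq_sum_iff_of_le hle).1 (h.sum_eq.trans hsum.symm) i (Finset.mem_range.2 hi)
  | succ m hm ih =>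
    rcases hm.eq_or_lt with rfl | hlt
    · exact h.step heven (fun i hi => (hd₀ i hi).trans (htwo i hi)) hsum
    have hpow : 2 ^ (m₀ + 1) ≤ 2 ^ m := Nat.pow_le_pow_right (by omega) hlt
    -- the even multiplicities `2 * c i` on the smaller space are found by interpolating between `1`
    -- and `d i / 2`
    obtain ⟨k, rfl⟩ : ∃ k, m = k + 1 := ⟨m - 1, by omega⟩
    have hhalf : ∀ i < r, d i = 2 * (d i / 2) := fun i hi => by
      have := Nat.even_iff.1 (heven i hi); omega
    have hs : 2 * ∑ i ∈ Finset.range r, d i / 2 = 2 ^ (k + 1 + 1) := by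
      rw [← hsum, Finset.mul_sum]
      exact Finset.sum_congr rfl fun i hi => (hhalf i (Finset.mem_range.1 hi)).symm
    obtain ⟨c, hc, hcs⟩ := exists_between_sum_eq (r := r) (M := 2 ^ k) (fun _ => 1)
      (fun i => d i / 2) (fun i hi => by have := htwo i hi; omega)
      (by simp; omega) (by rw [pow_succ, pow_succ] at hs; omega)
    refine (ih (d := fun i => 2 * c i) (fun i _ => even_two_mul _)
      (fun i hi => by have := (hc i hi).1; omega) ?_).step heven
      (fun i hi => by have := (hc i hi).2; have := hhalf i hi; omega) hsum
    rw [← Finset.mul_sum, hcs, pow_succ]; omega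

/-! ### Explicit spine matchings -/

/-- The vector of the `m` lowest binary digits of `a`. -/
def bitVector (m a : ℕ) : Fin m → ZMod 2 := fun i => if a.testBit i then 1 else 0

theorem bitVector_xor (m a b : ℕ) : bitVector m (a ^^^ b) = bitVector m a + bitVector m b := by
  funext i
  simp only [bitVector, Nat.testBit_xor, Pi.add_apply]
  cases a.testBit i <;> cases b.testBit i <;> decide

theorem bitVector_injOn (m : ℕ) : Set.InjOn (bitVector m) (Set.Iio (2 ^ m)) := by
  intro a ha b hb hab
  refine Nat.eq_of_testBit_eq fun i => ?_
  by_cases hi : i < m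
  · have := congrFun hab ⟨i, hi⟩
    simp only [bitVector] at this
    revert this
    cases a.testBit i <;> cases b.testBit i <;> simp
  · have hp : 2 ^ m ≤ 2 ^ i := Nat.pow_le_pow_right (by omega) (by omega)
    rw [Nat.testBit_lt_two_pow (lt_of_lt_of_le ha hp),
      Nat.testBit_lt_two_pow (lt_of_lt_of_le hb hp)]

theorem bitVector_bijective (m : ℕ) :
    Function.Bijective fun a : Fin (2 ^ m) => bitVector m a :=
  (Fintype.bijective_iff_injective_and_card _).2
    ⟨fun a b h => Fin.ext (bitVector_injOn m a.2 b.2 h), by simp⟩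

/-- The lists `T` and `F` describe a spine matching on `𝔽₂ᵐ`, vectors being written as numbers
below `2 ^ m` and added by `^^^`: `T` lists the vectors `t i`, and the entry of `F` in position `y`
is `φ y`. Moreover the last spine vertex is not used as a difference, and no other is used more than
twice. -/
def IsCertificate (m r : ℕ) (T F : List ℕ) : Prop :=
  (∀ a ∈ T, a < 2 ^ m) ∧ (∀ i < r, ∀ j < i, T.getD i 0 ≠ T.getD j 0) ∧
  (∀ i < r, F.getD (T.getD i 0) 0 = i - 1) ∧ (∀ a < 2 ^ m, F.getD a 0 < r) ∧
  ((List.range (2 ^ m)).map fun a => a ^^^ T.getD (F.getD a 0) 0).Nodup ∧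
  F.length = 2 ^ m ∧ F.count (r - 1) = 0 ∧ ∀ i < r, F.count i ≤ 2

instance (m r : ℕ) (T F : List ℕ) : Decidable (IsCertificate m r T F) := by
  unfold IsCertificate; infer_instance

theorem IsCertificate.hasSpineMatching {m r : ℕ} {T F : List ℕ} (h : IsCertificate m r T F) :
    HasSpineMatching m r fun i => F.count i := by
  obtain ⟨hT, hinj, hspine, hlt, hnodup, hF, -, -⟩ := h
  let e : Fin (2 ^ m) ≃ (Fin m → ZMod 2) := Equiv.ofBijective _ (bitVector_bijective m)
  have he : ∀ a, e a = bitVector m a := fun a => rfl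
  have hT' : ∀ i, T.getD i 0 < 2 ^ m := by
    intro i
    by_cases hi : i < T.length
    · rw [List.getD_eq_getElem _ _ hi]; exact hT _ (List.getElem_mem hi)
    · rw [List.getD_eq_default _ _ (by omega)]; positivity
  let φ : (Fin m → ZMod 2) → ℕ := fun y => F.getD (e.symm y) 0
  have hφ : ∀ a (ha : a < 2 ^ m), φ (bitVector m a) = F.getD a 0 := by
    intro a ha
    have : e.symm (bitVector m a) = ⟨a, ha⟩ := e.symm_apply_eq.2 rfl
    simp [φ, this]
  refine ⟨fun i => bitVector m (T.getD i 0), φ, ⟨?_, ?_, ?_, ?_⟩, ?_⟩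
  · intro i hi j hj hij
    have h1 := bitVector_injOn m (hT' i) (hT' j) hij
    rcases lt_trichotomy i j with h2 | h2 | h2
    · exact absurd h1.symm (hinj j hj i h2)
    · exact h2
    · exact absurd h1 (hinj i hi j h2)
  · intro i hi
    rw [hφ _ (hT' i), hspine i hi]
  · exact fun y => hlt _ (e.symm y).2
  · rw [← Finite.injective_iff_bijective]
    intro x y hxy
    obtain ⟨a, rfl⟩ := e.surjective x
    obtain ⟨b, rfl⟩ := e.surjective y
    simp only [he, hφ _ a.2, hφ _ b.2, ← bitVector_xor] at hxy
    have h1 := bitVector_injOn m (Nat.xor_lt_two_pow a.2 (hT' _))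
      (Nat.xor_lt_two_pow b.2 (hT' _)) hxy
    have h2 := List.inj_on_of_nodup_map hnodup (List.mem_range.2 a.2) (List.mem_range.2 b.2) h1
    rw [Fin.ext h2]
  · intro i _
    have h1 := Fin.card_filter_univ_eq_vector_get_eq_count i (⟨F, hF⟩ : List.Vector ℕ (2 ^ m))
    rw [← Fintype.card_subtype] at h1 ⊢
    refine (Fintype.card_congr (e.subtypeEquiv fun a => ?_)).symm.trans h1
    rw [he, hφ _ a.2, List.getD_eq_getElem _ _ (by rw [hF]; exact a.2)]
    rfl

/-- A certificate serves spines of `r` and of `r - 1` vertices. The assumption `hrl` says that the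
space `𝔽₂ᵐ⁰` is no larger than the smallest one on which a spine of `s` vertices with even
multiplicities at least 2 can be matched. -/
theorem IsCertificate.hasSpineMatching_of_even {m₀ m r s : ℕ} {T F : List ℕ} {d : ℕ → ℕ}
    (h : IsCertificate m₀ r T F) (hs : s = r ∨ s + 1 = r) (hrl : 2 ^ m₀ < 4 * s)
    (hru : 2 * s ≤ 2 ^ (m₀ + 1)) (heven : ∀ i < s, Even (d i)) (htwo : ∀ i < s, 2 ≤ d i)
    (hsum : ∑ i ∈ Finset.range s, d i = 2 ^ m) : HasSpineMatching m s d := by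
  have hcore : HasSpineMatching m₀ s fun i => F.count i := by
    rcases hs with rfl | rfl
    · exact h.hasSpineMatching
    · exact h.hasSpineMatching.of_succ (by simpa using h.2.2.2.2.2.2.1)
  refine hcore.of_core (fun i hi => h.2.2.2.2.2.2.2 i (by omega)) hru ?_ heven htwo hsum
  have h1 : 2 * s ≤ 2 ^ m := by
    rw [← hsum]
    calc 2 * s = ∑ i ∈ Finset.range s, 2 := by simp [mul_comm]
      _ ≤ _ := Finset.sum_le_sum fun i hi => htwo i (Finset.mem_range.1 hi)
  by_contra! hlt
  have := Nat.pow_le_pow_right (n := 2) (by omega) hlt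
  rw [Nat.pow_succ] at this
  omega

/-- For spines of at most 17 vertices all even multiplicities at least 2 with sum `2 ^ m` occur.
Here nine explicit matchings suffice, one for a spine of 2 vertices and one for each odd length from
3 to 17. -/
theorem hasSpineMatching_of_even {m r : ℕ} {d : ℕ → ℕ} (hr0 : 0 < r) (hr : r ≤ 17)
    (heven : ∀ i < r, Even (d i)) (htwo : ∀ i < r, 2 ≤ d i)
    (hsum : ∑ i ∈ Finset.range r, d i = 2 ^ m) : HasSpineMatching m r d := by
  have c2 : IsCertificate 1 2 [0, 1] [0, 0] := by decide
  have c3 : IsCertificate 2 3 [0, 1, 2] [0, 0, 1, 1] := by decide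
  have c5 : IsCertificate 3 5 [0, 1, 2, 4, 3] [0, 0, 1, 3, 2, 1, 3, 2] := by decide
  have c7 : IsCertificate 3 7 [0, 1, 2, 4, 3, 7, 5] [0, 0, 1, 3, 2, 5, 4, 4] := by decide
  have c9 : IsCertificate 4 9 [0, 9, 15, 1, 6, 7, 13, 5, 8]
    [0, 2, 6, 5, 3, 6, 3, 4, 7, 0, 4, 1, 2, 5, 7, 1] := by decide
  have c11 : IsCertificate 4 11 [0, 3, 10, 7, 11, 9, 12, 4, 5, 2, 8]
    [0, 3, 8, 0, 6, 7, 5, 2, 9, 4, 1, 3, 5, 1, 2, 7] := by decide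
  have c13 : IsCertificate 4 13 [0, 5, 11, 1, 14, 8, 3, 15, 2, 10, 13, 4, 7]
    [0, 2, 7, 5, 10, 0, 8, 11, 4, 2, 8, 1, 10, 9, 3, 6] := by decide
  have c15 : IsCertificate 4 15 [0, 2, 6, 13, 4, 12, 1, 11, 10, 15, 8, 7, 9, 5, 3]
    [0, 5, 0, 13, 3, 12, 1, 10, 9, 11, 7, 6, 4, 2, 3, 8] := by decide
  have c17 : IsCertificate 5 17 [0, 28, 15, 21, 1, 25, 29, 18, 4, 10, 6, 12, 9, 20, 11, 13, 31]
    [0, 3, 12, 6, 7, 8, 9, 1, 2, 11, 8, 13, 10, 14, 11, 1, 4, 5, 6, 9, 12, 2, 10, 13, 3, 4, 15, 7,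
      0, 5, 14, 15] := by decide
  interval_cases r
  · exact c2.hasSpineMatching_of_even (by omega) (by omega) (by omega) heven htwo hsum
  all_goals first
    | exact c3.hasSpineMatching_of_even (by omega) (by omega) (by omega) heven htwo hsum
    | exact c5.hasSpineMatching_of_even (by omega) (by omega) (by omega) heven htwo hsum
    | exact c7.hasSpineMatching_of_even (by omega) (by omega) (by omega) heven htwo hsum
    | exact c9.hasSpineMatching_of_even (by omega) (by omega) (by omega) heven htwo hsum
    | exact c11.hasSpineMatching_of_even (by omega) (by omega) (by omega) heven htwo hsum
    | exact c13.hasSpineMatching_of_even (by omega) (by omega) (by omega) heven htwo hsum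
    | exact c15.hasSpineMatching_of_even (by omega) (by omega) (by omega) heven htwo hsum
    | exact c17.hasSpineMatching_of_even (by omega) (by omega) (by omega) heven htwo hsum

/-! ### Labelling a rooted caterpillar -/

namespace SimpleGraph

variable {V : Type*}

/-- The vertices `s 0, …, s (r - 1)` form a path in `G`, every other vertex is adjacent to one of
them, and `k` gives the parent `s (k v)` of each vertex `v` when the tree is rooted at `s 0`. At the
root itself, `k` is `0` instead of undefined. Consecutive spine vertices are adjacent by `map_spine`
and `adj`. -/
structure IsRootedSpine (G : SimpleGraph V) (r : ℕ) (s : ℕ → V) (k : V → ℕ) : Prop where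
  pos : 0 < r
  injOn : Set.InjOn s (Set.Iio r)
  lt : ∀ v, k v < r
  map_spine : ∀ i < r, k (s i) = i - 1
  adj : ∀ v, v ≠ s 0 → G.Adj v (s (k v))

/-- Every edge joins a vertex to its parent: there are `|V| - 1` such edges, and a tree has
no more. -/
theorem IsRootedSpine.exists_of_mem_edgeSet [Finite V] {G : SimpleGraph V} {r : ℕ} {s : ℕ → V}
    {k : V → ℕ} (h : G.IsRootedSpine r s k) (hG : G.IsTree) {e : Sym2 V} (he : e ∈ G.edgeSet) :
    ∃ v, v ≠ s 0 ∧ s(v, s (k v)) = e := by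
  classical
  cases nonempty_fintype V
  have hinj : Set.InjOn (fun v => s(v, s (k v))) (Finset.univ.erase (s 0) : Finset V) := by
    intro v hv w hw hvw
    rcases Sym2.eq_iff.1 hvw with h1 | ⟨h1, h2⟩
    · exact h1.1
    · exfalso
      have e1 : k v = k w - 1 := by rw [h1]; exact h.map_spine _ (h.lt w)
      have e2 : k w = k v - 1 := by rw [← h2]; exact h.map_spine _ (h.lt v)
      apply (Finset.mem_erase.1 hv).1
      rw [h1, show k w = 0 by omega]
  have hmaps : Set.MapsTo (fun v => s(v, s (k v))) (Finset.univ.erase (s 0) : Finset V)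
      G.edgeFinset := by
    intro v hv
    rw [Finset.mem_coe, mem_edgeFinset]
    exact h.adj v (Finset.mem_erase.1 hv).1
  have hcard : G.edgeFinset.card ≤ (Finset.univ.erase (s 0)).card := by
    rw [Finset.card_erase_of_mem (Finset.mem_univ _), Finset.card_univ, ← hG.card_edgeFinset]
    omega
  obtain ⟨v, hv, hve⟩ := Finset.surjOn_of_injOn_of_card_le _ hmaps hinj hcard
    (Finset.mem_coe.2 (mem_edgeFinset.2 he))
  exact ⟨v, (Finset.mem_erase.1 hv).1, hve⟩

/-- If the numbers of children agree with the multiplicities of a spine matching, then the vertices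
can be identified with the vectors so that parents correspond to differences. -/
theorem IsRootedSpine.exists_bijective [Fintype V] {G : SimpleGraph V} {m r : ℕ}
    {s : ℕ → V} {k : V → ℕ} (h : G.IsRootedSpine r s k) {t : ℕ → Fin m → ZMod 2}
    {φ : (Fin m → ZMod 2) → ℕ} (hm : IsSpineMatching r t φ)
    (hcard : ∀ i < r, (Finset.univ.filter fun y => φ y = i).card =
      (Finset.univ.filter fun v => k v = i).card) :
    ∃ β : V → Fin m → ZMod 2, Function.Bijective β ∧ (∀ v, φ (β v) = k v) ∧
      ∀ i < r, β (s i) = t i := by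
  classical
  have hfib : ∀ i, i < r → ∃ g : V → Fin m → ZMod 2, (∀ v, k v = i → φ (g v) = i) ∧
      Set.InjOn g {v | k v = i} ∧ ∀ j < r, k (s j) = i → g (s j) = t j := by
    intro i hi
    obtain ⟨f, hf⟩ : ∃ f : V → Fin m → ZMod 2, ∀ j < r, f (s j) = t j := by
      refine ⟨fun v => t (Function.invFunOn s (Set.Iio r) v), fun j hj => ?_⟩
      have h1 : s j ∈ s '' Set.Iio r := ⟨j, hj, rfl⟩
      exact congrArg t (h.injOn (Function.invFunOn_mem h1) hj (Function.invFunOn_eq h1))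
    obtain ⟨g, hg⟩ := Finset.exists_equiv_extend_of_card_eq
      (α := {v // k v = i}) (t := Finset.univ.filter fun y => φ y = i)
      (by rw [hcard i hi, Fintype.card_subtype])
      (s := Finset.univ.filter fun v => ∃ j < r, s j = v.1) (f := fun v => f v.1)
      (by
        intro y hy
        simp only [Finset.mem_image, Finset.mem_filter, Finset.mem_univ, true_and] at hy ⊢
        obtain ⟨⟨_, hv⟩, ⟨j, hj, rfl⟩, rfl⟩ := hy
        rw [hf j hj, hm.map_spine j hj, ← h.map_spine j hj, hv])
      (by
        rintro ⟨_, hv⟩ hv' ⟨_, hw⟩ hw' hvw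
        simp only [Finset.coe_filter, Finset.mem_univ, true_and, Set.mem_ofPred_eq] at hv' hw'
        obtain ⟨j, hj, rfl⟩ := hv'
        obtain ⟨l, hl, rfl⟩ := hw'
        simp only [hf j hj, hf l hl] at hvw
        simp [hm.injOn hj hl hvw])
    refine ⟨fun v => if hv : k v = i then (g ⟨v, hv⟩ : Fin m → ZMod 2) else 0, ?_, ?_, ?_⟩
    · intro v hv
      simp only [hv, dif_pos]
      exact (Finset.mem_filter.1 (g ⟨v, hv⟩).2).2
    · intro v hv w hw hvw
      simp only [Set.mem_ofPred_eq] at hv hw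
      simp only [hv, hw, dif_pos] at hvw
      simpa using g.injective (Subtype.ext hvw)
    · intro j hj hk
      simp only [hk, dif_pos]
      rw [hg ⟨s j, hk⟩ (by simpa using ⟨j, hj, rfl⟩), hf j hj]
  choose! g hg1 hg2 hg3 using hfib
  have hφ : ∀ v, φ (g (k v) v) = k v := fun v => hg1 _ (h.lt v) v rfl
  have hinj : Function.Injective fun v => g (k v) v := by
    intro v w hvw
    have hk : k v = k w := by rw [← hφ v, ← hφ w]; exact congrArg φ hvw
    refine hg2 _ (h.lt w) hk rfl ?_
    simpa [hk] using hvw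
  refine ⟨_, (Fintype.bijective_iff_injective_and_card _).2 ⟨hinj, ?_⟩, hφ,
    fun i hi => hg3 _ (h.lt _) i hi rfl⟩
  rw [← Finset.card_univ, ← Finset.card_univ,
    Finset.card_eq_sum_card_fiberwise (f := k) (t := Finset.range r)
      fun v _ => Finset.mem_coe.2 (Finset.mem_range.2 (h.lt v)),
    Finset.card_eq_sum_card_fiberwise (f := φ) (t := Finset.range r)
      fun v _ => Finset.mem_coe.2 (Finset.mem_range.2 (hm.map_lt v))]
  exact Finset.sum_congr rfl fun i hi => (hcard i (Finset.mem_range.1 hi)).symm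

/-- The labeling obtained from a spine matching gives the label `(1, β v)` to the vertex `v`. The
edge from `v` to its parent then has the label `(0, β v + t (φ (β v)))`, and these are the two
members of a pair of the matching. -/
theorem IsRootedSpine.isSetSequential [Fintype V] {G : SimpleGraph V} {m r : ℕ}
    {s : ℕ → V} {k : V → ℕ} (h : G.IsRootedSpine r s k) (hG : G.IsTree)
    (hm : HasSpineMatching m r fun i => (Finset.univ.filter fun v => k v = i).card) :
    G.IsSetSequential := by
  obtain ⟨t, φ, hm, hcard⟩ := hm
  obtain ⟨β, hβ, hφ, hs⟩ := h.exists_bijective hm hcard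
  let e := consAddEquiv m
  let f : V → Fin (m + 1) → ZMod 2 := fun v => e (1, β v)
  have hedge : ∀ v, f v + f (s (k v)) = e (0, β v + t (φ (β v))) := by
    intro v
    simp only [f]
    rw [← map_add, hs _ (h.lt v), hφ, Prod.mk_add_mk, CharTwo.add_self_eq_zero]
  have hlabel : ∀ e' : G.edgeSet, ∃ v, v ≠ s 0 ∧ (e' : Sym2 V) = s(v, s (k v)) ∧
      G.inducedLabel f (Sum.inr e') = e (0, β v + t (φ (β v))) := by
    rintro ⟨e', he'⟩
    obtain ⟨v, hv, rfl⟩ := h.exists_of_mem_edgeSet hG he'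
    exact ⟨v, hv, rfl, hedge v⟩
  have hroot : β (s 0) + t (φ (β (s 0))) = 0 := by
    rw [hφ, h.map_spine 0 h.pos, hs 0 h.pos]
    funext i; exact CharTwo.add_self_eq_zero _
  have hne : ∀ v x, f v ≠ e (0, x) := fun v x hvx => by
    have := congrArg Prod.fst (e.injective hvx)
    exact one_ne_zero this
  have hinj : Function.Injective f := fun v w hvw =>
    hβ.1 (congrArg Prod.snd (e.injective hvw))
  refine ⟨m + 1, f, hinj, fun v hv => hne v 0 ?_, fun x hx => ?_⟩
  · rw [hv]; exact (map_zero e).symm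
  obtain ⟨⟨a, y⟩, rfl⟩ := e.surjective x
  have ha : a = 0 ∨ a = 1 := (by decide : ∀ a : ZMod 2, a = 0 ∨ a = 1) a
  rcases ha with rfl | rfl
  · obtain ⟨z, hz⟩ := hm.bijective.2 y
    obtain ⟨v, rfl⟩ := hβ.2 z
    have hv : v ≠ s 0 := by
      rintro rfl
      apply hx
      simp only at hz
      rw [← hz, hroot]
      exact map_zero e
    refine ⟨Sum.inr ⟨s(v, s (k v)), h.adj v hv⟩, ?_, ?_⟩
    · exact (hedge v).trans (by rw [← hz])
    · rintro (w | e') hw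
      · exact absurd hw (hne w y)
      · obtain ⟨w, -, hw1, hw2⟩ := hlabel e'
        replace hw := hw2.symm.trans hw
        have h1 := congrArg Prod.snd (e.injective hw)
        have h2 : w = v := hβ.1 (hm.bijective.1 (h1.trans hz.symm))
        subst h2
        exact congrArg Sum.inr (Subtype.ext hw1)
  · obtain ⟨v, rfl⟩ := hβ.2 y
    refine ⟨Sum.inl v, rfl, ?_⟩
    rintro (w | e') hw
    · exact congrArg Sum.inl (hinj hw)
    · obtain ⟨w, -, -, hw2⟩ := hlabel e'
      exact absurd (hw2.symm.trans hw).symm (hne v _)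

theorem IsRootedSpine.eq_or_eq_of_adj [Finite V] {G : SimpleGraph V} {r : ℕ} {s : ℕ → V}
    {k : V → ℕ} (h : G.IsRootedSpine r s k) (hG : G.IsTree) {i : ℕ} (hi : i < r) {u : V}
    (hu : G.Adj u (s i)) : k u = i ∨ (i ≠ 0 ∧ u = s (i - 1)) := by
  obtain ⟨w, hw0, hw⟩ := h.exists_of_mem_edgeSet hG (G.mem_edgeSet.2 hu)
  rcases Sym2.eq_iff.1 hw with ⟨rfl, h2⟩ | ⟨rfl, h2⟩
  · exact Or.inl (h.injOn (h.lt _) hi h2)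
  · refine Or.inr ⟨by rintro rfl; exact hw0 rfl, ?_⟩
    rw [← h2, h.map_spine i hi]

/-- The fiber of `k` over `i` consists of the children of `s i`, together with the root itself
if `i = 0`, so that it is even when the degree of `s i` is odd. -/
theorem IsRootedSpine.card_fiber [Fintype V] {G : SimpleGraph V} [DecidableRel G.Adj] {r : ℕ}
    {s : ℕ → V} {k : V → ℕ} (h : G.IsRootedSpine r s k) (hG : G.IsTree) {i : ℕ} (hi : i < r) :
    (Finset.univ.filter fun v => k v = i).card + 1 = G.degree (s i) + if i = 0 then 2 else 0 := by
  classical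
  have key := fun u => h.eq_or_eq_of_adj hG hi (u := u)
  rw [← card_neighborFinset_eq_degree]
  split_ifs with h0
  · subst h0
    have : (Finset.univ.filter fun v => k v = 0) = insert (s 0) (G.neighborFinset (s 0)) := by
      ext v
      simp only [Finset.mem_filter, Finset.mem_univ, true_and, Finset.mem_insert,
        mem_neighborFinset]
      constructor
      · intro hv
        by_cases hv0 : v = s 0
        · exact Or.inl hv0
        · exact Or.inr (hv ▸ h.adj v hv0).symm
      · rintro (rfl | hv)
        · exact h.map_spine 0 hi
        · exact (key v hv.symm).resolve_right (by simp)
    rw [this, Finset.card_insert_of_notMem (by simp)]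
  · have : G.neighborFinset (s i) = insert (s (i - 1)) (Finset.univ.filter fun v => k v = i) := by
      ext v
      simp only [Finset.mem_filter, Finset.mem_univ, true_and, Finset.mem_insert,
        mem_neighborFinset]
      constructor
      · intro hv
        rcases key v hv.symm with h1 | h1
        exacts [Or.inr h1, Or.inl h1.2]
      · rintro (rfl | hv)
        · have hne : s i ≠ s 0 := fun h1 => h0 (h.injOn hi h.pos h1)
          have := h.adj (s i) hne
          rwa [h.map_spine i hi] at this
        · refine (hv ▸ h.adj v ?_).symm
          rintro rfl
          exact h0 (by rw [← hv, h.map_spine 0 h.pos])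
    rw [this, Finset.card_insert_of_notMem, add_zero]
    simp only [Finset.mem_filter, Finset.mem_univ, true_and]
    rw [h.map_spine _ (by omega)]
    omega

end SimpleGraph

/-! ### The spine of a caterpillar -/

namespace SimpleGraph

variable {V : Type*}

/-- Every vertex lies on the walk or is adjacent to a vertex of the walk. -/
def Walk.IsDominating {G : SimpleGraph V} {u v : V} (p : G.Walk u v) : Prop :=
  ∀ x, x ∈ p.support ∨ ∃ y ∈ p.support, G.Adj x y

theorem IsCaterpillar.exists_isDominating {G : SimpleGraph V} (h : G.IsCaterpillar) :
    ∃ (u v : V) (p : G.Walk u v), p.IsPath ∧ p.IsDominating := by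
  obtain ⟨hG, u, v, p, hp, hd⟩ := h
  refine ⟨u, v, p, hp, fun x => ?_⟩
  obtain ⟨y, hy, hxy⟩ := hd x
  rcases Nat.le_one_iff_eq_zero_or_eq_one.1 hxy with h0 | h1
  · rw [hG.connected.dist_eq_zero_iff] at h0
    exact Or.inl (h0 ▸ hy)
  · exact Or.inr ⟨y, hy, dist_eq_one_iff_adj.1 h1⟩

/-- A shortest dominating path cannot be shortened at its first vertex, which therefore has a
neighbour outside the path. -/
theorem Walk.exists_adj_of_minimal {G : SimpleGraph V} {u v : V} {p : G.Walk u v}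
    (hp : p.IsPath) (hd : p.IsDominating) (hne : p.length ≠ 0)
    (hmin : ∀ (u' v' : V) (q : G.Walk u' v'), q.IsPath → q.IsDominating → p.length ≤ q.length) :
    ∃ x, x ∉ p.support ∧ G.Adj x u := by
  cases p with
  | nil => simp at hne
  | @cons _ w _ h q =>
    by_contra! hno
    have hq := hmin _ _ q hp.of_cons fun x => by
      rcases hd x with hx | ⟨y, hy, hxy⟩
      · rw [Walk.support_cons, List.mem_cons] at hx
        rcases hx with rfl | hx
        · exact Or.inr ⟨w, q.start_mem_support, h⟩
        · exact Or.inl hx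
      · rw [Walk.support_cons, List.mem_cons] at hy
        rcases hy with rfl | hy
        · have hx : x ∈ (Walk.cons h q).support := by
            by_contra hx
            exact hno x hx hxy
          rw [Walk.support_cons, List.mem_cons] at hx
          exact Or.inl (hx.resolve_left hxy.ne)
        · exact Or.inr ⟨y, hy, hxy⟩
    rw [Walk.length_cons] at hq
    omega

theorem IsAcyclic.length_eq_dist {G : SimpleGraph V} (hG : G.IsAcyclic) {u v : V}
    {p : G.Walk u v} (hp : p.IsPath) : p.length = G.dist u v := by
  obtain ⟨q, hq, hl⟩ := p.reachable.exists_path_of_dist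
  have := (hG.subsingleton_path u v).elim ⟨p, hp⟩ ⟨q, hq⟩
  exact (congrArg (fun p : G.Path u v => p.1.length) this).trans hl

/-- In a tree, a path with a further neighbour at each end extends to a longer path, which is a
geodesic because paths in a tree are unique. -/
theorem IsTree.length_add_two_le_diam [Finite V] {G : SimpleGraph V} (hG : G.IsTree) {u v x y : V}
    {p : G.Walk u v} (hp : p.IsPath) (hne : p.length ≠ 0) (hx : x ∉ p.support) (hxu : G.Adj x u)
    (hy : y ∉ p.support) (hyv : G.Adj y v) : p.length + 2 ≤ G.diam := by
  have hxp : (Walk.cons hxu p).IsPath := hp.cons hx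
  have hxy : y ≠ x := by
    rintro rfl
    have h1 := hG.isAcyclic.length_eq_dist hxp
    rw [dist_eq_one_iff_adj.2 hyv, Walk.length_cons] at h1
    omega
  have hq : ((Walk.cons hxu p).concat hyv.symm).IsPath := hxp.concat (by simp [hxy, hy]) _
  have : Nonempty V := ⟨u⟩
  have h1 := dist_le_diam (connected_iff_ediam_ne_top.1 hG.connected) (u := x) (v := y)
  rw [← hG.isAcyclic.length_eq_dist hq, Walk.length_concat, Walk.length_cons] at h1
  exact h1

/-- A shortest dominating path serves as a spine. It has at most `diam - 1` vertices unless it is a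
single vertex, and all its vertices have children, where the root counts as a child of itself. -/
theorem IsCaterpillar.exists_isRootedSpine [Finite V] {G : SimpleGraph V} (h : G.IsCaterpillar) :
    ∃ (r : ℕ) (s : ℕ → V) (k : V → ℕ), G.IsRootedSpine r s k ∧ (r = 1 ∨ r + 1 ≤ G.diam) ∧
      ∀ i < r, ∃ v, k v = i := by
  classical
  have hex : ∃ l, ∃ (u v : V) (p : G.Walk u v), p.length = l ∧ p.IsPath ∧ p.IsDominating := by
    obtain ⟨u, v, p, hp⟩ := h.exists_isDominating
    exact ⟨_, u, v, p, rfl, hp⟩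
  obtain ⟨u, v, p, hl, hp, hd⟩ := Nat.find_spec hex
  have hmin : ∀ (u' v' : V) (q : G.Walk u' v'), q.IsPath → q.IsDominating →
      p.length ≤ q.length := fun u' v' q hq hqd => by
    rw [hl]; exact Nat.find_min' hex ⟨u', v', q, rfl, hq, hqd⟩
  have hinj : Set.InjOn p.getVert (Set.Iio (p.length + 1)) :=
    hp.getVert_injOn.mono fun i hi => Nat.lt_succ_iff.1 hi
  have hpar : ∀ x, ∃ i < p.length + 1, (∀ j < p.length + 1, x = p.getVert j → i = j - 1) ∧
      (x ≠ p.getVert 0 → G.Adj x (p.getVert i)) := by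
    intro x
    by_cases hx : x ∈ p.support
    · obtain ⟨j, rfl, hj⟩ := Walk.mem_support_iff_exists_getVert.1 hx
      refine ⟨j - 1, by omega, fun j' hj' hjj => ?_, fun hne => ?_⟩
      · rw [hinj (Nat.lt_succ_of_le hj) hj' hjj]
      · have hj0 : j ≠ 0 := by rintro rfl; exact hne rfl
        have := p.adj_getVert_succ (i := j - 1) (by omega)
        rw [Nat.sub_add_cancel (by omega)] at this
        exact this.symm
    · obtain ⟨y, hy, hxy⟩ := (hd x).resolve_left hx
      obtain ⟨j, rfl, hj⟩ := Walk.mem_support_iff_exists_getVert.1 hy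
      refine ⟨j, by omega, fun j' hj' hjj => absurd ?_ hx, fun _ => hxy⟩
      rw [hjj]; exact p.getVert_mem_support j'
  choose k hk1 hk2 hk3 using hpar
  have hspine : G.IsRootedSpine (p.length + 1) p.getVert k :=
    ⟨by omega, hinj, hk1, fun i hi => hk2 _ i hi rfl, hk3⟩
  refine ⟨p.length + 1, p.getVert, k, hspine, ?_⟩
  rcases eq_or_ne p.length 0 with h0 | h0
  · refine ⟨Or.inl (by omega), fun i hi => ⟨p.getVert 0, ?_⟩⟩
    rw [hspine.map_spine 0 (by omega)]
    omega
  obtain ⟨x, hx, hxu⟩ := Walk.exists_adj_of_minimal hp hd h0 hmin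
  obtain ⟨y, hy, hyv⟩ := Walk.exists_adj_of_minimal (p := p.reverse) hp.reverse
    (fun x => by simpa using hd x) (by simpa using h0) (by simpa using hmin)
  rw [Walk.support_reverse, List.mem_reverse] at hy
  refine ⟨Or.inr (h.1.length_add_two_le_diam hp h0 hx hxu hy hyv), fun i hi => ?_⟩
  rcases (Nat.lt_succ_iff.1 hi).lt_or_eq with hi | rfl
  · exact ⟨p.getVert (i + 1), hspine.map_spine _ (by omega)⟩
  · refine ⟨y, ?_⟩
    have hadj : G.Adj y (p.getVert p.length) := by rwa [p.getVert_length]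
    refine (hspine.eq_or_eq_of_adj h.1 hi hadj).resolve_right fun hy' => hy ?_
    rw [hy'.2]
    exact p.getVert_mem_support _

end SimpleGraph

theorem mainTheorem1 {V : Type*} [Fintype V] (G : SimpleGraph V) [DecidableRel G.Adj]
    (hcat : G.IsCaterpillar) (hodd : ∀ v : V, Odd (G.degree v)) (hdiam : G.diam ≤ 18)
    (m : ℕ) (hcard : Fintype.card V = 2 ^ m) :
    G.IsSetSequential := by
  obtain ⟨r, s, k, h, hr, hne⟩ := hcat.exists_isRootedSpine
  refine h.isSetSequential hcat.1 (hasSpineMatching_of_even (m := m) h.pos (by omega) ?_ ?_ ?_)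
  · intro i hi
    have h1 := h.card_fiber hcat.1 hi
    obtain ⟨j, hj⟩ := hodd (s i)
    rw [Nat.even_iff]
    split_ifs at h1 <;> omega
  · intro i hi
    have h1 := h.card_fiber hcat.1 hi
    obtain ⟨j, hj⟩ := hodd (s i)
    obtain ⟨v, hv⟩ := hne i hi
    have h2 : 0 < (Finset.univ.filter fun v => k v = i).card :=
      Finset.card_pos.2 ⟨v, by simpa using hv⟩
    split_ifs at h1 <;> omega
  · rw [← hcard, ← Finset.card_univ, Finset.card_eq_sum_card_fiberwise (f := k)
      fun v _ => Finset.mem_coe.2 (Finset.mem_range.2 (h.lt v))]
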